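/- For a finite subset $A$ of an abelian group let $\mathrm{ST}(A)=|\{(x,y,z)\in A^3 : x+y=z\}|$ be the number of (ordered) Schur triples in $A$, whose entries need not be distinct. Let $p$ be an odd prime and order the elements of the $p$-element cyclic group $\mathbb{Z}_p$ as $x_1,\dots,x_p$, where \[ x_{2i}=\frac{p-1}{2}+i \qquad\text{and}\qquad x_{2i+1}=\frac{p-1}{2}-i . \] For every $A\subseteq\mathbb{Z}_p$ with $a$ elements, \[ \mathrm{ST}(A)\ \ge\ \mathrm{ST}(\{x_1,\dots,x_a\})=\begin{cases}0, & \text{if } a\le\frac{p+1}{3},\\[2pt] \left\lfloor\frac{3a-p}{2}\right\rfloor\left\lceil\frac{3a-p}{2}\right\rceil, & \text{if } a>\frac{p+1}{3}.\end{cases} \] Moreover, if $\mathrm{ST}(\{x_1,\dots,x_a\})>0$, then $\mathrm{ST}(A)=\mathrm{ST}(\{x_1,\dots,x_a\})$ only if $A=\varphi(\{x_1,\dots,x_a\})$ for some automorphism $\varphi$ of $\mathbb{Z}_p$, that is, only if $A=\xi\cdot\{x_1,\dots,x_a\}$ for some nonzero $\xi\in\mathbb{Z}_p$. -/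

import Mathlib

/-- The number `ST(A)` of triples `(x, y, z)` of elements of `A`, ordered and not necessarily
distinct, such that `x + y = z`. -/
def schurCount {G : Type*} [AddCommGroup G] [DecidableEq G] (A : Finset G) : ℕ :=
  ((A ×ˢ A ×ˢ A).filter fun t => t.1 + t.2.1 = t.2.2).card

/-- The elements `x_k` of `ZMod p` (`p` odd, `1 ≤ k ≤ p`), listed from the middle out:
`x_{2i} = (p - 1) / 2 + i` and `x_{2i+1} = (p - 1) / 2 - i`. In both cases `i = k / 2`, rounded
down, and `(p - 1) / 2` is a natural number since `p` is odd. -/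
def middleOut (p k : ℕ) : ZMod p :=
  if Even k then (((p - 1) / 2 : ℕ) : ZMod p) + ((k / 2 : ℕ) : ZMod p)
  else (((p - 1) / 2 : ℕ) : ZMod p) - ((k / 2 : ℕ) : ZMod p)

/-- The set `{x_1, …, x_a}`. -/
def middleSet (p a : ℕ) : Finset (ZMod p) :=
  (Finset.Icc 1 a).image (middleOut p)

/-! Write T(A, B, C) for `sumCount A B C`, and a = #A. As ST(A) = a² - T(A, A, Aᶜ), a lower bound
for ST is an upper bound for T. Pollard's theorem (`sumCount_add_sq_div_four_le`) gives T(A, B, C) ≤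
#A #B - ⌊s²/4⌋ with s = #A + #B - #C; for (A, A, Aᶜ) this has s = 3a - p. It needs 2a ≤ p; for
larger a it is applied to (Aᶜ, Aᶜ, Aᶜ), because ST(A) + ST(Aᶜ) depends only on a and p. Its proof is
an induction through the Dyson transform, which splits T(A, B, C) between the pairs (A ∪ B, A ∩ B)
and (A \ B, B \ A).

For uniqueness, equality in Pollard's theorem makes C a progression
(`exists_isProgression_of_sumCount_eq`): either equality passes to one of the Dyson pairs, or every
sum outside C has a unique representation and Vosper's theorem makes A and B progressions. Hence Aᶜ
is a progression, and after a dilation an interval. Equality also makes every element of C a popular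
sum, which centres the interval up to x ↦ -x. -/

section General

/-! ### Counting pairs with sum in a given set -/

open Finset
open scoped Pointwise

variable {G : Type*} [AddCommGroup G] [DecidableEq G]

/-- The number of pairs `(x, y) ∈ A × B` with `x + y ∈ C`. -/
def sumCount (A B C : Finset G) : ℕ := ∑ x ∈ A, ∑ y ∈ B, if x + y ∈ C then 1 else 0

lemma sumCount_comm (A B C : Finset G) : sumCount A B C = sumCount B A C := by
  unfold sumCount
  rw [Finset.sum_comm]
  simp only [add_comm]

lemma sumCount_union_left {A A' : Finset G} (h : Disjoint A A') (B C : Finset G) :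
    sumCount (A ∪ A') B C = sumCount A B C + sumCount A' B C := by
  unfold sumCount
  rw [Finset.sum_union h]

lemma sumCount_union_right (A : Finset G) {B B' : Finset G} (h : Disjoint B B') (C : Finset G) :
    sumCount A (B ∪ B') C = sumCount A B C + sumCount A B' C := by
  rw [sumCount_comm, sumCount_union_left h, sumCount_comm B, sumCount_comm B']

lemma sumCount_union_target (A B : Finset G) {C C' : Finset G} (h : Disjoint C C') :
    sumCount A B (C ∪ C') = sumCount A B C + sumCount A B C' := by
  unfold sumCount
  rw [← Finset.sum_add_distrib]
  refine Finset.sum_congr rfl fun x _ => ?_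
  rw [← Finset.sum_add_distrib]
  refine Finset.sum_congr rfl fun y _ => ?_
  have h0 : x + y ∈ C → x + y ∉ C' := fun h1 => Finset.disjoint_left.1 h h1
  by_cases h1 : x + y ∈ C <;> by_cases h2 : x + y ∈ C' <;> simp_all

/-- The Dyson transform preserves the number of solutions. -/
lemma sumCount_dyson (A B C : Finset G) :
    sumCount A B C = sumCount (A ∪ B) (A ∩ B) C + sumCount (A \ B) (B \ A) C := by
  have hA : A = A \ B ∪ A ∩ B := (Finset.sdiff_union_inter A B).symm
  have hB : B = B \ A ∪ A ∩ B := by rw [inter_comm]; exact (Finset.sdiff_union_inter B A).symm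
  have hU : A ∪ B = A ∪ B \ A := by simp
  have dA : Disjoint (A \ B) (A ∩ B) := Finset.disjoint_sdiff_inter A B
  have dB : Disjoint (B \ A) (A ∩ B) := by rw [inter_comm]; exact Finset.disjoint_sdiff_inter B A
  have h1 : sumCount A B C = sumCount A (B \ A) C + sumCount A (A ∩ B) C := by
    conv_lhs => rw [hB]
    exact sumCount_union_right A dB C
  have h2 : sumCount A (B \ A) C
      = sumCount (A \ B) (B \ A) C + sumCount (A ∩ B) (B \ A) C := by
    conv_lhs => enter [1]; rw [hA]
    exact sumCount_union_left dA _ C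
  -- Swapping the factors of (A ∩ B) × (B \ A) completes A × (A ∩ B) to (A ∪ B) × (A ∩ B).
  rw [h1, h2, hU, sumCount_union_left disjoint_sdiff, sumCount_comm (B \ A) (A ∩ B)]
  omega

lemma sumCount_vadd (e : G) (A B C : Finset G) :
    sumCount A (e +ᵥ B) (e +ᵥ C) = sumCount A B C := by
  unfold sumCount
  refine Finset.sum_congr rfl fun x _ => ?_
  rw [show e +ᵥ B = B.image (e +ᵥ ·) from rfl,
    Finset.sum_image (fun _ _ _ _ h => by simpa using h)]
  refine Finset.sum_congr rfl fun y _ => ?_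
  have : x + (e +ᵥ y) = e +ᵥ (x + y) := by simp only [vadd_eq_add]; abel
  simp only [this, Finset.vadd_mem_vadd_finset_iff]

lemma sumCount_le_card_mul_card (A B C : Finset G) : sumCount A B C ≤ #A * #B := by
  unfold sumCount
  rw [← smul_eq_mul, ← Finset.sum_const]
  refine Finset.sum_le_sum fun x _ => ?_
  rw [Finset.card_eq_sum_ones]
  exact Finset.sum_le_sum fun y _ => by split_ifs <;> simp

lemma sumCount_eq_card_mul_card {A B C : Finset G} (h : sumCount A B C = #A * #B)
    {x y : G} (hx : x ∈ A) (hy : y ∈ B) : x + y ∈ C := by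
  by_contra hxy
  have h1 : ∀ x' ∈ A, (∑ y ∈ B, if x' + y ∈ C then 1 else 0) ≤ #B := fun x' _ => by
    rw [Finset.card_eq_sum_ones]
    exact Finset.sum_le_sum fun y _ => by split_ifs <;> simp
  have h2 : (∑ y ∈ B, if x + y ∈ C then 1 else 0) < #B := by
    rw [Finset.card_eq_sum_ones]
    exact Finset.sum_lt_sum (fun y _ => by split_ifs <;> simp) ⟨y, hy, by simp [hxy]⟩
  have h3 := Finset.sum_lt_sum h1 ⟨x, hx, h2⟩
  rw [Finset.sum_const, smul_eq_mul] at h3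
  unfold sumCount at h
  omega

lemma sumCount_le_right_mul_target (A B C : Finset G) : sumCount A B C ≤ #B * #C := by
  rw [sumCount_comm]
  unfold sumCount
  rw [← smul_eq_mul, ← Finset.sum_const]
  refine Finset.sum_le_sum fun y _ => ?_
  rw [← Finset.card_filter]
  exact Finset.card_le_card_of_injOn (fun x => y + x) (by intro x; simp)
    (fun _ _ _ _ h => by simpa using h)

variable [Fintype G]

lemma sumCount_add_compl_target (A B C : Finset G) :
    sumCount A B C + sumCount A B Cᶜ = #A * #B := by
  rw [← sumCount_union_target A B disjoint_compl_right, Finset.union_compl]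
  simp [sumCount]

/-- With `x` ranging over the whole group, each `y ∈ B` and each target in `C` determine exactly one
`x`. -/
lemma sumCount_add_compl_left (A B C : Finset G) :
    sumCount A B C + sumCount Aᶜ B C = #B * #C := by
  rw [← sumCount_union_left disjoint_compl_right, Finset.union_compl, sumCount_comm]
  unfold sumCount
  rw [← smul_eq_mul, ← Finset.sum_const]
  refine Finset.sum_congr rfl fun y _ => ?_
  rw [← Finset.card_filter]
  refine Finset.card_nbij (fun x => y + x) (by intro x; simp)
    (fun _ _ _ _ h => by simpa using h) ?_
  intro z hz
  exact ⟨z - y, by simpa using hz, by simp⟩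

omit [Fintype G] in
lemma schurCount_eq_sumCount (A : Finset G) : schurCount A = sumCount A A A := by
  unfold schurCount sumCount
  simp only [Finset.card_filter, Finset.sum_product]
  refine Finset.sum_congr rfl fun x _ => Finset.sum_congr rfl fun y _ => ?_
  simp

lemma schurCount_add_sumCount_compl (A : Finset G) :
    schurCount A + sumCount A A Aᶜ = #A * #A := by
  rw [schurCount_eq_sumCount, sumCount_add_compl_target]

/-- The number of Schur triples of a set and of its complement determine each other. -/
lemma schurCount_add_schurCount_compl (A : Finset G) :
    schurCount A + schurCount Aᶜ + #A * #Aᶜ = #A * #A + #Aᶜ * #Aᶜ := by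
  -- Three complementations, one per entry, lead from T(A, A, A) through T(A, A, Aᶜ) and T(A, Aᶜ,
  -- Aᶜ) to T(Aᶜ, Aᶜ, Aᶜ).
  have h1 := schurCount_add_sumCount_compl A
  have h2 := sumCount_add_compl_left A A Aᶜ
  have h3 := sumCount_add_compl_left A Aᶜ Aᶜ
  rw [sumCount_comm Aᶜ A] at h2
  rw [schurCount_eq_sumCount Aᶜ]
  omega

omit [Fintype G] in
lemma card_inter_vadd_pos {A B : Finset G} {e : G} :
    0 < #(A ∩ (e +ᵥ B)) ↔ e ∈ A - B := by
  rw [Finset.card_pos, Finset.mem_sub]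
  constructor
  · rintro ⟨x, hx⟩
    obtain ⟨hx, y, hy, rfl⟩ := by simpa [Finset.mem_vadd_finset] using hx
    exact ⟨e + y, hx, y, hy, by simp⟩
  · rintro ⟨x, hx, y, hy, rfl⟩
    exact ⟨x, by simpa [Finset.mem_vadd_finset, hx] using ⟨y, hy, by simp⟩⟩

end General

/-- The change of ⌊s²/4⌋ when a Dyson step lowers s by 2k; it also eliminates the floor in parity
arguments. -/
lemma add_two_mul_sq_div_four (s k : ℕ) : (s + 2 * k) ^ 2 / 4 = s ^ 2 / 4 + k * (s + k) := by
  rw [show (s + 2 * k) ^ 2 = s ^ 2 + 4 * (k * (s + k)) by ring,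
    Nat.add_mul_div_left _ _ (by norm_num)]

/-! ### Pollard's theorem -/

section ZMod

open Finset
open scoped Pointwise

variable {p : ℕ} [Fact p.Prime]

/-- If every translate of `B` meeting `A` lay inside `A`, then (A - B) + B ⊆ A, which contradicts
two applications of Cauchy–Davenport. -/
lemma exists_proper_inter_vadd {A B : Finset (ZMod p)} (hB : 2 ≤ #B) (hBA : #B ≤ #A)
    (hp : #A + #B ≤ p) : ∃ e : ZMod p, 0 < #(A ∩ (e +ᵥ B)) ∧ #(A ∩ (e +ᵥ B)) < #B := by
  by_contra! H
  have hA0 : A.Nonempty := Finset.card_pos.1 (by omega)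
  have hB0 : B.Nonempty := Finset.card_pos.1 (by omega)
  have h1 : (A - B) + B ⊆ A := by
    intro z hz
    obtain ⟨e, he, y, hy, rfl⟩ := Finset.mem_add.1 hz
    have h2 := H e (card_inter_vadd_pos.2 he)
    have h3 : A ∩ (e +ᵥ B) = e +ᵥ B :=
      Finset.eq_of_subset_of_card_le Finset.inter_subset_right (by simpa using h2)
    have h4 : e + y ∈ e +ᵥ B := Finset.mem_vadd_finset.2 ⟨y, hy, rfl⟩
    rw [← h3] at h4
    exact (Finset.mem_inter.1 h4).1
  have h2 := ZMod.cauchy_davenport (Fact.out : p.Prime) hA0 hB0.neg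
  rw [← sub_eq_add_neg, Finset.card_neg] at h2
  have h3 := ZMod.cauchy_davenport (Fact.out : p.Prime) (hA0.sub hB0) hB0
  have h4 := Finset.card_le_card h1
  omega

/-- Pollard's theorem, in the form of an upper bound for the number of `(x, y) ∈ A × B` whose sum
lies in a given set. -/
theorem sumCount_add_sq_div_four_le (A B C : Finset (ZMod p)) (s : ℕ) (hBA : #B ≤ #A)
    (hp : #A + #B ≤ p) (hs : #C + s = #A + #B) (hsB : s ≤ 2 * #B) :
    sumCount A B C + s ^ 2 / 4 ≤ #A * #B := by
  induction hn : #A * #B using Nat.strong_induction_on generalizing A B C s with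
  | _ n ih =>
  subst hn
  have hab := sumCount_le_card_mul_card A B C
  have hbc := sumCount_le_right_mul_target A B C
  by_cases h1 : s ≤ 1
  · have : s ^ 2 / 4 = 0 := by interval_cases s <;> rfl
    omega
  -- For s = 2 #B and s = 2 #B - 1 the trivial bound #B #C is already the claim.
  by_cases h2 : 2 * #B ≤ s + 1
  · obtain h | h : s = 0 + 2 * #B ∨ s = 1 + 2 * (#B - 1) := by omega
    · have : #A = #C + #B := by omega
      rw [h, add_two_mul_sq_div_four, this]
      norm_num
      nlinarith
    · obtain ⟨k, hk⟩ : ∃ k, #B = k + 1 := ⟨#B - 1, by omega⟩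
      have : #A = #C + k := by omega
      rw [h, add_two_mul_sq_div_four, this, hk, Nat.add_sub_cancel]
      rw [hk] at hbc
      norm_num
      nlinarith
  obtain ⟨e, he0, heB⟩ := exists_proper_inter_vadd (by omega) hBA hp
  rw [← sumCount_vadd e]
  rw [← Finset.card_vadd_finset e B] at hBA hp hs hsB h2 heB ih ⊢
  rw [← Finset.card_vadd_finset e C] at hs
  clear hab hbc
  generalize e +ᵥ B = B at *
  generalize e +ᵥ C = C at *
  rw [sumCount_dyson]
  have hU := Finset.card_union_add_card_inter A B
  have hA' := Finset.card_sdiff_add_card_inter A B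
  have hB' := Finset.card_sdiff_add_card_inter B A
  rw [inter_comm] at hB'
  have hab := sumCount_le_card_mul_card (A \ B) (B \ A) C
  have hbc := sumCount_le_right_mul_target (A ∪ B) (A ∩ B) C
  have hu : #(A ∪ B) = #(A \ B) + #(B \ A) + #(A ∩ B) := by omega
  -- Induct on one Dyson pair and bound the other trivially: union and intersection keep `s`, while
  -- the differences lower it by 2 #(A ∩ B). Both have a smaller product of sizes.
  by_cases hi : s ≤ 2 * #(A ∩ B)
  · have := ih (#(A ∪ B) * #(A ∩ B)) (by rw [← hA', ← hB', hu]; nlinarith) (A ∪ B) (A ∩ B) C s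
      (by omega) (by omega) (by omega) hi rfl
    rw [← hA', ← hB']
    rw [hu] at this
    nlinarith
  · obtain ⟨r, rfl⟩ : ∃ r, s = r + 2 * #(A ∩ B) := ⟨s - 2 * #(A ∩ B), by omega⟩
    have := ih (#(A \ B) * #(B \ A)) (by rw [← hA', ← hB']; nlinarith) (A \ B) (B \ A) C r
      (by omega) (by omega) (by omega) (by omega) rfl
    rw [add_two_mul_sq_div_four, ← hA', ← hB']
    have hc : #C + r = #(A \ B) + #(B \ A) := by omega
    have : #(A ∩ B) * (#C + r) = #(A ∩ B) * (#(A \ B) + #(B \ A)) := by rw [hc]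
    nlinarith

end ZMod

/-! ### Arithmetic progressions in `ZMod p` and critical sumsets -/

section Progressions

open Finset
open scoped Pointwise

variable {p : ℕ}

/-- The arithmetic progression `x, x + d, …, x + (n - 1) d` in `ZMod p`. -/
def progression (d x : ZMod p) (n : ℕ) : Finset (ZMod p) :=
  (Finset.range n).image fun j : ℕ => x + j * d

lemma mem_progression {d x y : ZMod p} {n : ℕ} :
    y ∈ progression d x n ↔ ∃ j < n, x + (j : ZMod p) * d = y := by
  simp [progression]

lemma progression_add (d x y : ZMod p) (m n : ℕ) :
    progression d x (m + 1) + progression d y (n + 1) = progression d (x + y) (m + n + 1) := by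
  ext z
  simp only [Finset.mem_add, mem_progression]
  constructor
  · rintro ⟨_, ⟨i, hi, rfl⟩, _, ⟨j, hj, rfl⟩, rfl⟩
    exact ⟨i + j, by omega, by push_cast; ring⟩
  · rintro ⟨k, hk, rfl⟩
    refine ⟨_, ⟨min k m, by omega, rfl⟩, _, ⟨k - min k m, by omega, rfl⟩, ?_⟩
    rw [Nat.cast_sub (min_le_left k m)]
    ring

lemma progression_neg (d x : ZMod p) (n : ℕ) :
    -progression d x (n + 1) = progression d (-(x + n * d)) (n + 1) := by
  ext z
  simp only [Finset.mem_neg, mem_progression]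
  constructor
  · rintro ⟨_, ⟨j, hj, rfl⟩, rfl⟩
    exact ⟨n - j, by omega, by rw [Nat.cast_sub (by omega)]; ring⟩
  · rintro ⟨j, hj, rfl⟩
    exact ⟨_, ⟨n - j, by omega, rfl⟩, by rw [Nat.cast_sub (by omega)]; ring⟩

lemma vadd_progression (e d x : ZMod p) (n : ℕ) :
    e +ᵥ progression d x n = progression d (e + x) n := by
  ext z
  simp only [Finset.mem_vadd_finset, mem_progression, vadd_eq_add]
  constructor
  · rintro ⟨_, ⟨j, hj, rfl⟩, rfl⟩
    exact ⟨j, hj, by ring⟩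
  · rintro ⟨j, hj, rfl⟩
    exact ⟨_, ⟨j, hj, rfl⟩, by ring⟩

lemma image_mul_progression (ξ d x : ZMod p) (n : ℕ) :
    (progression d x n).image (ξ * ·) = progression (ξ * d) (ξ * x) n := by
  ext z
  simp only [Finset.mem_image, mem_progression]
  constructor
  · rintro ⟨_, ⟨j, hj, rfl⟩, rfl⟩
    exact ⟨j, hj, by ring⟩
  · rintro ⟨j, hj, rfl⟩
    exact ⟨_, ⟨j, hj, rfl⟩, by ring⟩

variable [Fact p.Prime]

lemma natCast_mul_inj {d : ZMod p} (hd : d ≠ 0) {i j : ℕ} (hi : i < p) (hj : j < p)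
    (h : (i : ZMod p) * d = j * d) : i = j := by
  have h1 := congrArg ZMod.val (mul_right_cancel₀ hd h)
  rwa [ZMod.val_natCast_of_lt hi, ZMod.val_natCast_of_lt hj] at h1

lemma card_progression {d : ZMod p} (hd : d ≠ 0) (x : ZMod p) {n : ℕ} (hn : n ≤ p) :
    #(progression d x n) = n := by
  unfold progression
  rw [Finset.card_image_of_injOn, Finset.card_range]
  intro i hi j hj h
  simp only [Finset.coe_range, Set.mem_Iio] at hi hj
  exact natCast_mul_inj hd (by omega) (by omega) (add_left_cancel h)

lemma exists_eq_add_mul {d : ZMod p} (hd : d ≠ 0) (x y : ZMod p) :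
    ∃ j < p, x + (j : ZMod p) * d = y := by
  refine ⟨((y - x) / d).val, ZMod.val_lt _, ?_⟩
  rw [ZMod.natCast_zmod_val]
  field_simp
  ring

lemma compl_progression {d : ZMod p} (hd : d ≠ 0) (x : ZMod p) {n : ℕ} (hn : n ≤ p) :
    (progression d x n)ᶜ = progression d (x + n * d) (p - n) := by
  symm
  apply Finset.eq_of_subset_of_card_le
  · intro y hy
    rw [Finset.mem_compl]
    intro hy'
    obtain ⟨i, hi, rfl⟩ := mem_progression.1 hy
    obtain ⟨j, hj, h⟩ := mem_progression.1 hy'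
    have := natCast_mul_inj hd (i := n + i) (j := j) (by omega) (by omega)
      (by push_cast; linear_combination -h)
    omega
  · rw [Finset.card_compl, ZMod.card, card_progression hd _ hn, card_progression hd _ (by omega)]

/-- A set that is an arithmetic progression with difference `d`. -/
def IsProgression (d : ZMod p) (A : Finset (ZMod p)) : Prop :=
  ∃ x, A = progression d x #A

lemma isProgression_progression {d : ZMod p} (hd : d ≠ 0) (x : ZMod p) {n : ℕ} (hn : n ≤ p) :
    IsProgression d (progression d x n) :=
  ⟨x, by rw [card_progression hd x hn]⟩

lemma card_le_prime (A : Finset (ZMod p)) : #A ≤ p := by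
  simpa [ZMod.card] using Finset.card_le_univ A

lemma IsProgression.compl {d : ZMod p} (hd : d ≠ 0) {A : Finset (ZMod p)}
    (h : IsProgression d A) : IsProgression d Aᶜ := by
  obtain ⟨x, hx⟩ := h
  rw [hx, compl_progression hd x (card_le_prime A)]
  exact isProgression_progression hd _ (by omega)

lemma IsProgression.neg {d : ZMod p} (hd : d ≠ 0) {A : Finset (ZMod p)}
    (h : IsProgression d A) : IsProgression d (-A) := by
  obtain ⟨x, hx⟩ := h
  have := card_le_prime A
  obtain h0 | ⟨n, hn⟩ : #A = 0 ∨ ∃ n, #A = n + 1 := by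
    cases #A <;> simp
  · rw [Finset.card_eq_zero.1 h0]
    exact ⟨0, by simp [progression]⟩
  · rw [hx, hn, progression_neg]
    exact isProgression_progression hd _ (by omega)

lemma IsProgression.vadd {d : ZMod p} {A : Finset (ZMod p)} (e : ZMod p)
    (h : IsProgression d A) : IsProgression d (e +ᵥ A) := by
  obtain ⟨x, hx⟩ := h
  refine ⟨e + x, ?_⟩
  rw [Finset.card_vadd_finset, ← vadd_progression, ← hx]

lemma IsProgression.of_vadd {d : ZMod p} {A : Finset (ZMod p)} (e : ZMod p)
    (h : IsProgression d (e +ᵥ A)) : IsProgression d A := by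
  simpa using h.vadd (-e)

lemma add_zero_pair (A : Finset (ZMod p)) (d : ZMod p) : A + {0, d} = A ∪ (d +ᵥ A) := by
  ext z
  simp only [Finset.mem_add, Finset.mem_insert, Finset.mem_singleton, Finset.mem_union,
    Finset.mem_vadd_finset, vadd_eq_add]
  constructor
  · rintro ⟨x, hx, y, rfl | rfl, rfl⟩
    · exact Or.inl (by simpa using hx)
    · exact Or.inr ⟨x, hx, add_comm _ _⟩
  · rintro (hz | ⟨x, hx, rfl⟩)
    · exact ⟨z, hz, 0, Or.inl rfl, by simp⟩
    · exact ⟨x, hx, d, Or.inr rfl, add_comm _ _⟩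

/-- A proper subset of `ZMod p` that gains at most one element when its translate by `d` is added
is a progression with difference `d`. -/
lemma isProgression_of_card_add_pair_le {d : ZMod p} (hd : d ≠ 0) {A : Finset (ZMod p)}
    (hA : A.Nonempty) (hAp : #A < p) (h : #(A ∪ (d +ᵥ A)) ≤ #A + 1) : IsProgression d A := by
  have hcd := ZMod.cauchy_davenport (Fact.out : p.Prime) hA (Finset.insert_nonempty 0 {d})
  rw [add_zero_pair, Finset.card_pair hd.symm] at hcd
  -- Exactly one element of `A` has no predecessor in `A`; it will be the first term.
  have h1 : #(A \ (d +ᵥ A)) = 1 := by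
    have := Finset.card_sdiff_add_card A (d +ᵥ A)
    rw [Finset.card_vadd_finset] at this
    omega
  obtain ⟨x, hx⟩ := Finset.card_eq_one.1 h1
  have hstep : ∀ y ∈ A, y ≠ x → y - d ∈ A := by
    intro y hy hyx
    by_contra hyd
    have : y ∈ A \ (d +ᵥ A) := by
      simp only [Finset.mem_sdiff, hy, Finset.mem_vadd_finset, vadd_eq_add, true_and]
      rintro ⟨z, hz, rfl⟩
      exact hyd (by simpa using hz)
    rw [hx, Finset.mem_singleton] at this
    exact hyx this
  have hdown : ∀ j < p, x + (j : ZMod p) * d ∈ A → ∀ i ≤ j, x + (i : ZMod p) * d ∈ A := by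
    intro j
    induction j with
    | zero => intro _ h i hi; simpa [Nat.le_zero.1 hi] using h
    | succ j ih =>
      intro hj h i hi
      rcases Nat.eq_or_lt_of_le hi with rfl | hi
      · exact h
      · refine ih (by omega) ?_ i (by omega)
        have := hstep _ h (fun h0 => ?_)
        · convert this using 1; push_cast; ring
        · have := natCast_mul_inj hd (i := j + 1) (j := 0) hj (by omega)
            (by rw [Nat.cast_zero]; linear_combination h0)
          omega
  refine ⟨x, Finset.eq_of_subset_of_card_le ?_ ?_⟩
  · intro y hy
    obtain ⟨j, hj, rfl⟩ := exists_eq_add_mul hd x y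
    refine mem_progression.2 ⟨j, ?_, rfl⟩
    have hsub : progression d x (j + 1) ⊆ A := by
      intro z hz
      obtain ⟨i, hi, rfl⟩ := mem_progression.1 hz
      exact hdown j hj hy i (by omega)
    have := Finset.card_le_card hsub
    rw [card_progression hd x (by omega)] at this
    omega
  · rw [card_progression hd x hAp.le]

/-- If `C` is a progression and `#(A + C) ≤ #A + #C - 1 < p`, then `A` is a progression. -/
lemma isProgression_of_card_add_le {d : ZMod p} (hd : d ≠ 0) {A C : Finset (ZMod p)}
    (hA : A.Nonempty) (hC : IsProgression d C) (hC2 : 2 ≤ #C) (hp : #A + #C ≤ p)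
    (h : #(A + C) + 1 ≤ #A + #C) : IsProgression d A := by
  obtain ⟨x, hx⟩ := hC
  obtain ⟨n, hn⟩ : ∃ n, #C = n + 2 := ⟨#C - 2, by omega⟩
  refine isProgression_of_card_add_pair_le hd hA (by omega) ?_
  -- Splitting off {0, d} from `C` lets Cauchy–Davenport for (A + {0, d}) + C' bound #(A + {0, d})
  -- by #A + 1.
  have hC' : C = progression d 0 2 + progression d x (n + 1) := by
    rw [progression_add, hx, hn]
    congr 1 <;> ring
  have hpair : A + progression d 0 2 = A ∪ (d +ᵥ A) := by
    rw [← add_zero_pair]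
    simp [progression, Finset.range_add_one, Finset.pair_comm]
  have hne : (progression d x (n + 1)).Nonempty :=
    ⟨x, mem_progression.2 ⟨0, by omega, by simp⟩⟩
  have hcd := ZMod.cauchy_davenport (Fact.out : p.Prime) (s := A ∪ (d +ᵥ A))
    (hA.mono Finset.subset_union_left) hne
  rw [← hpair, add_assoc, ← hC', hpair, card_progression hd x (by omega)] at hcd
  omega

/-- A progression that is a critical sumset has summands that are progressions. -/
lemma isProgression_left_of_add {d : ZMod p} (hd : d ≠ 0) {A B : Finset (ZMod p)}
    (hA : 0 < #A) (hB : 0 < #B) (hp : #A + #B + 1 ≤ p) (hAB : #(A + B) + 1 = #A + #B)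
    (h : IsProgression d (A + B)) : IsProgression d A := by
  have hC : IsProgression d (A + B)ᶜ := h.compl hd
  have hCc : #(A + B)ᶜ + #(A + B) = p := by
    rw [Finset.card_compl_add_card, ZMod.card]
  have hBc : #Bᶜ + #B = p := by
    rw [Finset.card_compl_add_card, ZMod.card]
  -- Duality: -A and (A + B)ᶜ again form a critical pair, now with one summand known to be a
  -- progression.
  have hsub : -A + (A + B)ᶜ ⊆ Bᶜ := by
    intro z hz
    obtain ⟨x, hx, c, hc, rfl⟩ := Finset.mem_add.1 hz
    rw [Finset.mem_compl] at hc ⊢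
    intro hb
    exact hc (Finset.mem_add.2 ⟨-x, by simpa using hx, _, hb, by ring⟩)
  have hle := Finset.card_le_card hsub
  have hA' : #(-A) = #A := Finset.card_neg A
  have := isProgression_of_card_add_le hd (A := -A) (Finset.card_pos.1 (by omega)) hC (by omega)
    (by omega) (by omega)
  simpa using this.neg hd

end Progressions

/-! ### Vosper's theorem and equality in Pollard's theorem -/

section Inverse

open Finset
open scoped Pointwise

variable {p : ℕ} [Fact p.Prime]

lemma IsProgression.add {d : ZMod p} (hd : d ≠ 0) {A B : Finset (ZMod p)}
    (hA : IsProgression d A) (hB : IsProgression d B) (hA0 : 0 < #A) (hB0 : 0 < #B)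
    (hp : #A + #B ≤ p + 1) : IsProgression d (A + B) := by
  obtain ⟨x, hx⟩ := hA
  obtain ⟨y, hy⟩ := hB
  obtain ⟨m, hm⟩ : ∃ m, #A = m + 1 := ⟨#A - 1, by omega⟩
  obtain ⟨n, hn⟩ : ∃ n, #B = n + 1 := ⟨#B - 1, by omega⟩
  rw [hx, hy, hm, hn, progression_add]
  exact isProgression_progression hd _ (by omega)

lemma add_vadd_right (e : ZMod p) (A B : Finset (ZMod p)) : A + (e +ᵥ B) = e +ᵥ (A + B) := by
  rw [add_comm A, vadd_add_assoc, add_comm B]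

/-- Suppose not and fix y ∈ B. Translates e + B ⊆ A number at most #A - #B + 1, so at least #B - 1
of the e ∈ A - y give e + B meeting `A` only in e + y. Their other points avoid `A`, so A + B has at
least #A + 2 #B - 3 elements, too many once #B ≥ 3. -/
lemma exists_two_le_inter_vadd {A B : Finset (ZMod p)} (hB : 3 ≤ #B) (hBA : #B ≤ #A)
    (hp : #A + #B ≤ p) (h : #(A + B) + 1 ≤ #A + #B) :
    ∃ e : ZMod p, 2 ≤ #(A ∩ (e +ᵥ B)) ∧ #(A ∩ (e +ᵥ B)) < #B := by
  by_contra! H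
  have hprime : p.Prime := Fact.out
  have hA0 : A.Nonempty := Finset.card_pos.1 (by omega)
  obtain ⟨y, hy⟩ : B.Nonempty := Finset.card_pos.1 (by omega)
  set E := (-y) +ᵥ A with hE
  have hEc : #E = #A := by simp [hE]
  have hmemE : ∀ e, e ∈ E ↔ e + y ∈ A := by
    intro e
    rw [hE, Finset.mem_vadd_finset]
    exact ⟨by rintro ⟨z, hz, rfl⟩; simpa [add_comm, add_left_comm] using hz,
      fun h => ⟨_, h, by simp⟩⟩
  set E₁ := E.filter fun e => e +ᵥ B ⊆ A with hE₁
  set E₂ := E.filter fun e => ¬ (e +ᵥ B ⊆ A) with hE₂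
  have hsplit : #E₁ + #E₂ = #A := by
    rw [← hEc]; exact Finset.card_filter_add_card_filter_not _
  have h1 : #E₁ + #B ≤ #A + 1 := by
    rcases E₁.eq_empty_or_nonempty with h0 | h0
    · rw [h0, Finset.card_empty]; omega
    · have hcd := ZMod.cauchy_davenport hprime h0 ⟨y, hy⟩
      have hsub : E₁ + B ⊆ A := by
        intro z hz
        obtain ⟨e, he, b, hb, rfl⟩ := Finset.mem_add.1 hz
        exact (Finset.mem_filter.1 he).2 (Finset.mem_vadd_finset.2 ⟨b, hb, rfl⟩)
      have := Finset.card_le_card hsub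
      omega
  have h2 : Disjoint (E₂ + B.erase y) A := by
    rw [Finset.disjoint_left]
    intro z hz hzA
    obtain ⟨e, he, b, hb, rfl⟩ := Finset.mem_add.1 hz
    obtain ⟨heE, hne⟩ := Finset.mem_filter.1 he
    obtain ⟨hby, hb⟩ := Finset.mem_erase.1 hb
    have h3 : 2 ≤ #(A ∩ (e +ᵥ B)) := by
      refine Finset.one_lt_card.2 ⟨e + b, ?_, e + y, ?_, by simpa using hby⟩
      · exact Finset.mem_inter.2 ⟨hzA, Finset.mem_vadd_finset.2 ⟨b, hb, rfl⟩⟩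
      · exact Finset.mem_inter.2 ⟨(hmemE e).1 heE, Finset.mem_vadd_finset.2 ⟨y, hy, rfl⟩⟩
    have h4 := H e h3
    have h5 : A ∩ (e +ᵥ B) = e +ᵥ B :=
      Finset.eq_of_subset_of_card_le Finset.inter_subset_right (by simpa using h4)
    exact hne (h5 ▸ Finset.inter_subset_left)
  have h3 : -y +ᵥ ((E₂ + B.erase y) ∪ A) ⊆ -y +ᵥ (-y +ᵥ (A + B)) := by
    rw [Finset.vadd_finset_subset_vadd_finset_iff]
    intro z hz
    refine Finset.mem_vadd_finset.2 ⟨y + z, ?_, by simp⟩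
    rcases Finset.mem_union.1 hz with hz | hz
    · obtain ⟨e, he, b, hb, rfl⟩ := Finset.mem_add.1 hz
      exact Finset.mem_add.2 ⟨e + y, (hmemE e).1 (Finset.mem_filter.1 he).1, b,
        Finset.mem_of_mem_erase hb, by ring⟩
    · exact Finset.mem_add.2 ⟨z, hz, y, hy, add_comm _ _⟩
  have h4 := Finset.card_le_card h3
  simp only [Finset.card_vadd_finset] at h4
  rw [Finset.card_union_of_disjoint h2] at h4
  have hBe : #(B.erase y) = #B - 1 := Finset.card_erase_of_mem hy
  have hcd := ZMod.cauchy_davenport hprime (s := E₂) (t := B.erase y)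
    (Finset.card_pos.1 (by omega)) (Finset.card_pos.1 (by omega))
  omega

/-- Vosper's theorem, with the sumset rather than the summands shown to be a progression. -/
theorem exists_isProgression_add {A B : Finset (ZMod p)} (hB : 2 ≤ #B) (hBA : #B ≤ #A)
    (hp : #A + #B + 1 ≤ p) (h : #(A + B) + 1 ≤ #A + #B) :
    ∃ d : ZMod p, d ≠ 0 ∧ IsProgression d (A + B) := by
  induction hn : #B using Nat.strong_induction_on generalizing A B with
  | _ n ih =>
  subst hn
  rcases Nat.eq_or_lt_of_le hB with hB2 | hB3
  · obtain ⟨y, z, hyz, rfl⟩ := Finset.card_eq_two.1 hB2.symm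
    have hd : z - y ≠ 0 := sub_ne_zero.2 hyz.symm
    have hBp : ({y, z} : Finset (ZMod p)) = y +ᵥ ({0, z - y} : Finset (ZMod p)) := by
      ext w
      simp [Finset.mem_vadd_finset, eq_comm]
    refine ⟨z - y, hd, ?_⟩
    have hAB : A + {y, z} = y +ᵥ (A ∪ ((z - y) +ᵥ A)) := by
      rw [hBp, ← add_zero_pair, add_vadd_right]
    rw [hAB, Finset.card_vadd_finset, ← hB2] at h
    have hA := isProgression_of_card_add_pair_le hd (A := A) (Finset.card_pos.1 (by omega))
      (by omega) (by omega)
    refine IsProgression.add hd hA ⟨y, ?_⟩ (by omega) (by omega) (by omega)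
    rw [← hB2]
    simp [progression, Finset.range_add_one, Finset.pair_comm]
  · obtain ⟨e, he2, heB⟩ := exists_two_le_inter_vadd hB3 hBA (by omega) h
    have hU := Finset.card_union_add_card_inter A (e +ᵥ B)
    rw [Finset.card_vadd_finset] at hU
    have hsub : (A ∪ (e +ᵥ B)) + (A ∩ (e +ᵥ B)) ⊆ A + (e +ᵥ B) := by
      intro z hz
      obtain ⟨u, hu, i, hi, rfl⟩ := Finset.mem_add.1 hz
      obtain ⟨hiA, hiB⟩ := Finset.mem_inter.1 hi
      rcases Finset.mem_union.1 hu with hu | hu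
      · exact Finset.add_mem_add hu hiB
      · rw [add_comm u]; exact Finset.add_mem_add hiA hu
    have hvadd := add_vadd_right e A B
    have hle := Finset.card_le_card hsub
    have hc : #(A + (e +ᵥ B)) = #(A + B) := by rw [hvadd, Finset.card_vadd_finset]
    have hcd := ZMod.cauchy_davenport (Fact.out : p.Prime) (s := A ∪ (e +ᵥ B))
      (t := A ∩ (e +ᵥ B)) (Finset.card_pos.1 (by omega)) (Finset.card_pos.1 (by omega))
    obtain ⟨d, hd, hprog⟩ := ih _ heB (A := A ∪ (e +ᵥ B)) (B := A ∩ (e +ᵥ B)) he2 (by omega) (by omega) (by omega) rfl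
    -- The transform preserves #A + #B, so Cauchy–Davenport forces the same sumset; hence the
    -- induction is on the sumset.
    have heq := Finset.eq_of_subset_of_card_le hsub (by omega)
    rw [heq, hvadd] at hprog
    exact ⟨d, hd, hprog.of_vadd⟩

lemma two_le_sumCount {A B C : Finset (ZMod p)} {x x' y y' : ZMod p} (hx : x ∈ A) (hx' : x' ∈ A)
    (hy : y ∈ B) (hy' : y' ∈ B) (hne : x ≠ x') (h : x + y ∈ C) (h' : x' + y' ∈ C) :
    2 ≤ sumCount A B C := by
  have : sumCount A B C = #((A ×ˢ B).filter fun q => q.1 + q.2 ∈ C) := by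
    rw [Finset.card_filter, Finset.sum_product]; rfl
  rw [this]
  exact Finset.one_lt_card.2 ⟨(x, y), by simp [*], (x', y'), by simp [*], by simp [hne]⟩

/-- If every element of `A + B` outside `C` has a unique representation, where `A` and `B` are
progressions, then `C` contains all but the two extreme elements of `A + B`. -/
lemma isProgression_of_unique_representations {d : ZMod p} (hd : d ≠ 0) {A B C : Finset (ZMod p)}
    (hA : IsProgression d A) (hB : IsProgression d B) (hA2 : 2 ≤ #A) (hB2 : 2 ≤ #B)
    (hp : #A + #B + 1 ≤ p) {s : ℕ} (hs : #C + s = #A + #B) (hs2 : 2 ≤ s)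
    (hT : sumCount A B C + s ^ 2 / 4 = #A * #B)
    (huniq : ∀ x ∈ A, ∀ y ∈ B, x + y ∉ C → ∀ x' ∈ A, ∀ y' ∈ B, x' + y' = x + y → x' = x) :
    IsProgression d C := by
  obtain ⟨x, hx⟩ := hA
  obtain ⟨y, hy⟩ := hB
  obtain ⟨m, hm⟩ : ∃ m, #A = m + 2 := ⟨#A - 2, by omega⟩
  obtain ⟨n, hn⟩ : ∃ n, #B = n + 2 := ⟨#B - 2, by omega⟩
  have memA : ∀ i < m + 2, x + (i : ZMod p) * d ∈ A := fun i hi => by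
    rw [hx, hm]; exact mem_progression.2 ⟨i, hi, rfl⟩
  have memB : ∀ i < n + 2, y + (i : ZMod p) * d ∈ B := fun i hi => by
    rw [hy, hn]; exact mem_progression.2 ⟨i, hi, rfl⟩
  -- An interior sum has two representations, (i + 1) + k = i + (k + 1), so it cannot lie outside
  -- `C`.
  have hint : ∀ j < m + n + 1, x + y + ((j + 1 : ℕ) : ZMod p) * d ∈ C := by
    intro j hj
    by_contra hC
    obtain ⟨i, k, hik, hi, hk⟩ : ∃ i k, i + k = j ∧ i < m + 1 ∧ k < n + 1 :=
      ⟨min j m, j - min j m, by omega, by omega, by omega⟩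
    have h1 : x + y + ((j + 1 : ℕ) : ZMod p) * d
        = (x + ((i + 1 : ℕ) : ZMod p) * d) + (y + (k : ZMod p) * d) := by
      rw [← hik]; push_cast; ring
    rw [h1] at hC
    have h2 := huniq _ (memA (i + 1) (by omega)) _ (memB k (by omega)) hC
      _ (memA i (by omega)) _ (memB (k + 1) (by omega)) (by push_cast; ring)
    have := natCast_mul_inj hd (by omega) (by omega) (add_left_cancel h2)
    omega
  have hsub : progression d (x + y + d) (m + n + 1) ⊆ C := by
    intro z hz
    obtain ⟨j, hj, rfl⟩ := mem_progression.1 hz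
    convert hint j hj using 1
    push_cast; ring
  have hle := Finset.card_le_card hsub
  rw [card_progression hd _ (by omega)] at hle
  obtain rfl | rfl : s = 2 ∨ s = 3 := by omega
  · have h1 := sumCount_add_compl_target A B C
    have h2 : x + y ∈ C ∨ x + y + ((m + n + 2 : ℕ) : ZMod p) * d ∈ C := by
      -- For s = 2 only ⌊s²/4⌋ = 1 pair has its sum outside `C`, so one extreme sum must be in `C`.
      by_contra! h
      have h3 : 2 ≤ sumCount A B Cᶜ := by
        refine two_le_sumCount (memA 0 (by omega)) (memA (m + 1) (by omega)) (memB 0 (by omega))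
          (memB (n + 1) (by omega)) (fun h0 => ?_) ?_ ?_
        · have := natCast_mul_inj hd (by omega) (by omega) (add_left_cancel h0)
          omega
        · simpa using h.1
        · rw [Finset.mem_compl]
          convert h.2 using 2
          push_cast; ring
      omega
    rcases h2 with h2 | h2
    · have : progression d (x + y) (m + n + 2) = C := by
        refine Finset.eq_of_subset_of_card_le ?_ (by rw [card_progression hd _ (by omega)]; omega)
        intro z hz
        obtain ⟨j, hj, rfl⟩ := mem_progression.1 hz
        rcases j with _ | j
        · simpa using h2
        · exact hint j (by omega)
      rw [← this]
      exact isProgression_progression hd _ (by omega)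
    · have : progression d (x + y + d) (m + n + 2) = C := by
        refine Finset.eq_of_subset_of_card_le ?_ (by rw [card_progression hd _ (by omega)]; omega)
        intro z hz
        obtain ⟨j, hj, rfl⟩ := mem_progression.1 hz
        rcases Nat.lt_or_ge j (m + n + 1) with hj' | hj'
        · convert hint j hj' using 1
          push_cast; ring
        · convert h2 using 1
          rw [show j = m + n + 1 by omega]
          push_cast; ring
      rw [← this]
      exact isProgression_progression hd _ (by omega)
  · have : progression d (x + y + d) (m + n + 1) = C :=
      Finset.eq_of_subset_of_card_le hsub (by rw [card_progression hd _ (by omega)]; omega)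
    rw [← this]
    exact isProgression_progression hd _ (by omega)

/-- The case of equality in Pollard's theorem: the set of popular sums is a progression. -/
theorem exists_isProgression_of_sumCount_eq (A B C : Finset (ZMod p)) (s : ℕ) (hBA : #B ≤ #A)
    (hp : #A + #B + 1 ≤ p) (hs : #C + s = #A + #B) (hs2 : 2 ≤ s) (hsB : s + 2 ≤ 2 * #B)
    (hT : sumCount A B C + s ^ 2 / 4 = #A * #B) :
    ∃ d : ZMod p, d ≠ 0 ∧ IsProgression d C := by
  induction hn : #A * #B using Nat.strong_induction_on generalizing A B C s with
  | _ n ih =>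
  subst hn
  by_cases hgood : ∃ e : ZMod p, 0 < #(A ∩ (e +ᵥ B)) ∧ #(A ∩ (e +ᵥ B)) < #B ∧
      (s + 2 ≤ 2 * #(A ∩ (e +ᵥ B)) ∨ 2 * #(A ∩ (e +ᵥ B)) + 2 ≤ s)
  · obtain ⟨e, he0, heB, hgood⟩ := hgood
    suffices ∃ d : ZMod p, d ≠ 0 ∧ IsProgression d (e +ᵥ C) from
      this.imp fun d h => ⟨h.1, h.2.of_vadd⟩
    rw [← sumCount_vadd e] at hT
    rw [← Finset.card_vadd_finset e B] at hBA hp hs hsB heB ih hT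
    rw [← Finset.card_vadd_finset e C] at hs
    generalize e +ᵥ B = B at *
    generalize e +ᵥ C = C at *
    rw [sumCount_dyson] at hT
    have hU := Finset.card_union_add_card_inter A B
    have hA' := Finset.card_sdiff_add_card_inter A B
    have hB' := Finset.card_sdiff_add_card_inter B A
    rw [inter_comm] at hB'
    have hab := sumCount_le_card_mul_card (A \ B) (B \ A) C
    have hbc := sumCount_le_right_mul_target (A ∪ B) (A ∩ B) C
    have hu : #(A ∪ B) = #(A \ B) + #(B \ A) + #(A ∩ B) := by omega
    rcases hgood with hi | hi
    · have hP := sumCount_add_sq_div_four_le (A ∪ B) (A ∩ B) C s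
        (by omega) (by omega) (by omega) (by omega)
      refine ih (#(A ∪ B) * #(A ∩ B)) (by rw [← hA', ← hB', hu]; nlinarith) (A ∪ B) (A ∩ B) C s
        (by omega) (by omega) (by omega) hs2 hi ?_ rfl
      rw [← hA', ← hB'] at hT
      rw [hu] at hP ⊢
      linarith
    · obtain ⟨r, rfl⟩ : ∃ r, s = r + 2 * #(A ∩ B) := ⟨s - 2 * #(A ∩ B), by omega⟩
      have hP := sumCount_add_sq_div_four_le (A \ B) (B \ A) C r
        (by omega) (by omega) (by omega) (by omega)
      refine ih (#(A \ B) * #(B \ A)) (by rw [← hA', ← hB']; nlinarith) (A \ B) (B \ A) C r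
        (by omega) (by omega) (by omega) (by omega) (by omega) ?_ rfl
      rw [add_two_mul_sq_div_four, ← hA', ← hB'] at hT
      have hc : #C + r = #(A \ B) + #(B \ A) := by omega
      have : #(A ∩ B) * (#C + r) = #(A ∩ B) * (#(A \ B) + #(B \ A)) := by rw [hc]
      linarith
  push Not at hgood
  have hq : 1 ≤ s ^ 2 / 4 := by
    rw [Nat.le_div_iff_mul_le (by norm_num)]; nlinarith
  have hprime : p.Prime := Fact.out
  have hA0 : A.Nonempty := Finset.card_pos.1 (by omega)
  have hB0 : B.Nonempty := Finset.card_pos.1 (by omega)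
  -- Now a translate e + B that meets `A` without lying in it has |s - 2 #(A ∩ (e + B))| ≤ 1, and
  -- equality then puts all sums of the two differences in e + C. If `e` were in neither set, x + (e
  -- + y) would be such a sum.
  have hcover : ∀ x ∈ A, ∀ y ∈ B, x + y ∉ C → A - B ⊆ (-y +ᵥ A) ∪ (x +ᵥ -B) := by
    intro x hx y hy hxy e he
    by_contra hne
    rw [Finset.mem_union, not_or] at hne
    have hye : e + y ∉ A := fun h => hne.1 (Finset.mem_vadd_finset.2 ⟨_, h, by simp⟩)
    have hxe : x - e ∉ B := fun h => hne.2 (Finset.mem_vadd_finset.2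
      ⟨-(x - e), by simpa using h, by simp⟩)
    have he0 := card_inter_vadd_pos.2 he
    have hxe' : x ∉ e +ᵥ B := fun h => by
      obtain ⟨b, hb, rfl⟩ := Finset.mem_vadd_finset.1 h
      exact hxe (by simpa using hb)
    have hye' : e + y ∈ e +ᵥ B := Finset.mem_vadd_finset.2 ⟨y, hy, rfl⟩
    have heB : #(A ∩ (e +ᵥ B)) < #B := by
      rw [← Finset.card_vadd_finset e B]
      exact Finset.card_lt_card ⟨Finset.inter_subset_right,
        fun h => hye (Finset.mem_inter.1 (h hye')).1⟩
    obtain ⟨hi1, hi2⟩ := hgood e he0 heB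
    have hxyC : x + (e + y) ∉ e +ᵥ C := fun h => by
      obtain ⟨c, hc, hce⟩ := Finset.mem_vadd_finset.1 h
      rw [vadd_eq_add] at hce
      exact hxy (by rwa [show x + y = c by linear_combination -hce])
    rw [← sumCount_vadd e] at hT
    rw [← Finset.card_vadd_finset e B] at hs heB hT
    rw [← Finset.card_vadd_finset e C] at hs
    clear hne hgood ih
    generalize e +ᵥ B = B at *
    generalize e +ᵥ C = C at *
    rw [sumCount_dyson] at hT
    have hU := Finset.card_union_add_card_inter A B
    have hA' := Finset.card_sdiff_add_card_inter A B
    have hB' := Finset.card_sdiff_add_card_inter B A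
    rw [inter_comm] at hB'
    have hab := sumCount_le_card_mul_card (A \ B) (B \ A) C
    have hbc := sumCount_le_right_mul_target (A ∪ B) (A ∩ B) C
    refine hxyC (sumCount_eq_card_mul_card (A := A \ B) (B := B \ A) ?_
      (Finset.mem_sdiff.2 ⟨hx, hxe'⟩) (Finset.mem_sdiff.2 ⟨hye', hye⟩))
    refine le_antisymm hab ?_
    rw [← hA', ← hB'] at hT
    obtain h | h | h : s = 2 * #(A ∩ B) ∨ s = 1 + 2 * #(A ∩ B) ∨ s = 1 + 2 * (#(A ∩ B) - 1) := by
      omega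
    · have hc : #C = #(A \ B) + #(B \ A) := by omega
      rw [hc] at hbc
      have := add_two_mul_sq_div_four 0 #(A ∩ B)
      rw [zero_add, ← h] at this
      norm_num only at this
      linarith
    · have hc : #(A \ B) + #(B \ A) = #C + 1 := by omega
      have hc' : #(A ∩ B) * (#(A \ B) + #(B \ A)) = #(A ∩ B) * (#C + 1) := by rw [hc]
      have := add_two_mul_sq_div_four 1 #(A ∩ B)
      rw [← h] at this
      norm_num at this
      linarith
    · have hc : #C = #(A \ B) + #(B \ A) + 1 := by omega
      rw [hc] at hbc
      have := add_two_mul_sq_div_four 1 (#(A ∩ B) - 1)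
      rw [← h, Nat.add_sub_cancel' he0] at this
      norm_num at this
      obtain ⟨k, hk⟩ : ∃ k, #(A ∩ B) = k + 1 := ⟨#(A ∩ B) - 1, by omega⟩
      rw [hk] at this hbc hT
      rw [Nat.add_sub_cancel] at this
      linarith
  have hABcd := ZMod.cauchy_davenport hprime hA0 hB0.neg
  rw [← sub_eq_add_neg, Finset.card_neg] at hABcd
  -- The intersection counts representations of x + y. As #(A - B) ≥ #A + #B - 1, it has at most one
  -- element, and A, -B are critical for Vosper's theorem.
  have hcard : ∀ x ∈ A, ∀ y ∈ B, x + y ∉ C →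
      #(A - B) + #((-y +ᵥ A) ∩ (x +ᵥ -B)) ≤ #A + #B := by
    intro x hx y hy hxy
    have h1 := Finset.card_le_card (hcover x hx y hy hxy)
    have h2 := Finset.card_union_add_card_inter (-y +ᵥ A) (x +ᵥ -B)
    rw [Finset.card_vadd_finset, Finset.card_vadd_finset, Finset.card_neg] at h2
    omega
  have hmem : ∀ x ∈ A, ∀ y ∈ B, ∀ x' ∈ A, ∀ y' ∈ B, x' + y' = x + y →
      x' - y ∈ (-y +ᵥ A) ∩ (x +ᵥ -B) := by
    intro x _ y _ x' hx' y' hy' h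
    refine Finset.mem_inter.2 ⟨Finset.mem_vadd_finset.2 ⟨x', hx', ?_⟩,
      Finset.mem_vadd_finset.2 ⟨-y', by simpa using hy', ?_⟩⟩
    · rw [vadd_eq_add]; ring
    · rw [vadd_eq_add]; linear_combination -h
  obtain ⟨x, hx, y, hy, hxy⟩ : ∃ x ∈ A, ∃ y ∈ B, x + y ∉ C := by
    by_contra! h
    have : sumCount A B C = #A * #B := by
      unfold sumCount
      rw [← smul_eq_mul, ← Finset.sum_const]
      refine Finset.sum_congr rfl fun x hx => ?_
      rw [Finset.card_eq_sum_ones]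
      exact Finset.sum_congr rfl fun y hy => by simp [h x hx y hy]
    omega
  have hpos : 0 < #((-y +ᵥ A) ∩ (x +ᵥ -B)) :=
    Finset.card_pos.2 ⟨_, hmem x hx y hy x hx y hy rfl⟩
  have hle := hcard x hx y hy hxy
  obtain ⟨d, hd, hprog⟩ := exists_isProgression_add (A := A) (B := -B)
    (by rw [Finset.card_neg]; omega) (by rwa [Finset.card_neg]) (by rw [Finset.card_neg]; omega)
    (by rw [← sub_eq_add_neg, Finset.card_neg]; omega)
  have hAB : #(A + -B) + 1 = #A + #(-B) := by
    rw [← sub_eq_add_neg, Finset.card_neg]; omega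
  have hBn : #(-B) = #B := Finset.card_neg B
  have hAprog := isProgression_left_of_add hd (by omega) (by omega) (by omega) hAB hprog
  rw [add_comm A] at hAB hprog
  have hBprog := isProgression_left_of_add hd (by omega) (by omega) (by omega) (by omega) hprog
  have hBprog' : IsProgression d B := by simpa using hBprog.neg hd
  refine ⟨d, hd, isProgression_of_unique_representations hd hAprog hBprog' (by omega) (by omega)
    hp hs hs2 hT ?_⟩
  intro x hx y hy hxy x' hx' y' hy' h
  have h1 := hcard x hx y hy hxy
  have h2 := Finset.card_le_one.1 (show #((-y +ᵥ A) ∩ (x +ᵥ -B)) ≤ 1 by omega)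
    _ (hmem x hx y hy x' hx' y' hy' h) _ (hmem x hx y hy x hx y hy rfl)
  exact sub_left_injective h2

end Inverse

/-! ### Schur triples of the middle set, and the lower bound -/

section MiddleSet

open Finset
open scoped Pointwise

variable {p : ℕ} [Fact p.Prime]

lemma middleSet_eq_progression (hp : Odd p) {a : ℕ} (ha : a ≤ p) :
    middleSet p a = progression 1 (((p - a + 1) / 2 : ℕ) : ZMod p) a := by
  symm
  obtain ⟨q, rfl⟩ := hp
  apply Finset.eq_of_subset_of_card_le
  · intro z hz
    obtain ⟨j, hj, rfl⟩ := mem_progression.1 hz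
    refine Finset.mem_image.2 ?_
    set m := (2 * q + 1 - a + 1) / 2 with hm
    have hq : (2 * q + 1 - 1) / 2 = q := by omega
    unfold middleOut
    rw [hq]
    rcases Nat.lt_or_ge q (m + j) with h | h
    · refine ⟨2 * (m + j - q), Finset.mem_Icc.2 ⟨by omega, by omega⟩, ?_⟩
      rw [if_pos (even_two_mul _), Nat.mul_div_cancel_left _ (by norm_num), Nat.cast_sub h.le]
      push_cast; ring
    · refine ⟨2 * (q - (m + j)) + 1, Finset.mem_Icc.2 ⟨by omega, by omega⟩, ?_⟩
      rw [if_neg (by simp [parity_simps]),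
        show (2 * (q - (m + j)) + 1) / 2 = q - (m + j) by omega, Nat.cast_sub h]
      push_cast; ring
  · rw [card_progression one_ne_zero _ ha]
    exact Finset.card_image_le.trans (by simp)

lemma card_middleSet (hp : Odd p) {a : ℕ} (ha : a ≤ p) : #(middleSet p a) = a := by
  rw [middleSet_eq_progression hp ha, card_progression one_ne_zero _ ha]

lemma bijOn_middleOut (hp : Odd p) : Set.BijOn (middleOut p) (Set.Icc 1 p) Set.univ := by
  have hc := card_middleSet (p := p) hp le_rfl
  refine ⟨Set.mapsTo_univ _ _, ?_, ?_⟩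
  · rw [← Finset.coe_Icc, ← Finset.card_image_iff]
    simpa [middleSet] using hc
  · have hu : middleSet p p = Finset.univ := by
      rw [← Finset.card_eq_iff_eq_univ, hc, ZMod.card]
    intro z _
    have hz : z ∈ middleSet p p := by rw [hu]; exact Finset.mem_univ z
    simpa [middleSet] using hz

/-- The pairs of natural numbers with sum less than `n`. -/
def triangle (n : ℕ) : Finset (ℕ × ℕ) :=
  (Finset.range n ×ˢ Finset.range n).filter fun q => q.1 + q.2 < n

lemma mem_triangle {n i j : ℕ} : (i, j) ∈ triangle n ↔ i + j < n := by
  simp [triangle]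
  omega

lemma two_mul_card_triangle_le (n : ℕ) : 2 * #(triangle n) ≤ n * (n + 1) := by
  induction n with
  | zero => simp [triangle]
  | succ n ih =>
    have hsub : triangle (n + 1) ⊆
        triangle n ∪ (Finset.range (n + 1)).image fun i => (i, n - i) := by
      rintro ⟨i, j⟩ h
      rw [mem_triangle] at h
      rw [Finset.mem_union, mem_triangle]
      by_cases h' : i + j < n
      · exact Or.inl h'
      · exact Or.inr (Finset.mem_image.2 ⟨i, Finset.mem_range.2 (by omega), by
          rw [Prod.mk.injEq]; omega⟩)
    have h1 := (Finset.card_le_card hsub).trans (Finset.card_union_le _ _)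
    have h2 := Finset.card_image_le (s := Finset.range (n + 1)) (f := fun i => (i, n - i))
    rw [Finset.card_range] at h2
    nlinarith

lemma natCast_eq_of_lt_two_mul {x z : ℕ} (hx : x < 2 * p) (hz : z < p)
    (h : (x : ZMod p) = z) : x = z ∨ x = z + p := by
  rw [ZMod.natCast_eq_natCast_iff'] at h
  rw [Nat.mod_eq_of_lt hz] at h
  rcases Nat.lt_or_ge x p with hxp | hxp
  · rw [Nat.mod_eq_of_lt hxp] at h
    exact Or.inl h
  · rw [Nat.mod_eq_sub_mod hxp, Nat.mod_eq_of_lt (by omega)] at h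
    omega

/-- A triple has either no wraparound or exactly one; offsets from the lower, respectively upper,
end of the interval place the two kinds in triangles. -/
lemma schurCount_progression_le {m a : ℕ} (hm : m + a ≤ p) :
    schurCount (progression (1 : ZMod p) (m : ZMod p) a)
      ≤ #(triangle (a - m)) + #(triangle (2 * a + m - 1 - p)) := by
  have hsub : ((progression (1 : ZMod p) (m : ZMod p) a ×ˢ progression (1 : ZMod p) (m : ZMod p) a
        ×ˢ progression (1 : ZMod p) (m : ZMod p) a).filter fun t => t.1 + t.2.1 = t.2.2) ⊆
      ((triangle (a - m)).image fun q =>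
        (((m + q.1 : ℕ) : ZMod p), ((m + q.2 : ℕ) : ZMod p),
          ((m + q.1 + (m + q.2) : ℕ) : ZMod p))) ∪
      ((triangle (2 * a + m - 1 - p)).image fun q =>
        (((m + (a - 1 - q.1) : ℕ) : ZMod p), ((m + (a - 1 - q.2) : ℕ) : ZMod p),
          ((m + (a - 1 - q.1) + (m + (a - 1 - q.2)) : ℕ) : ZMod p))) := by
    rintro ⟨x, y, z⟩ h
    simp only [Finset.mem_filter, Finset.mem_product, mem_progression] at h
    obtain ⟨⟨⟨i, hi, rfl⟩, ⟨j, hj, rfl⟩, ⟨k, hk, rfl⟩⟩, h⟩ := h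
    have h1 : ((m + i + (m + j) : ℕ) : ZMod p) = ((m + k : ℕ) : ZMod p) := by
      push_cast
      linear_combination h
    rw [Finset.mem_union, Finset.mem_image, Finset.mem_image]
    rcases natCast_eq_of_lt_two_mul (by omega) (by omega) h1 with h2 | h2
    · refine Or.inl ⟨(i, j), mem_triangle.2 (by omega), ?_⟩
      rw [h1]
      simp
    · refine Or.inr ⟨(a - 1 - i, a - 1 - j), mem_triangle.2 (by omega), ?_⟩
      simp only [show a - 1 - (a - 1 - i) = i by omega, show a - 1 - (a - 1 - j) = j by omega]
      rw [h1]
      simp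
  exact (Finset.card_le_card hsub).trans ((Finset.card_union_le _ _).trans
    (Nat.add_le_add Finset.card_image_le Finset.card_image_le))

lemma schurCount_middleSet_eq_zero (hp : Odd p) {a : ℕ} (ha : 3 * a ≤ p + 1) :
    schurCount (middleSet p a) = 0 := by
  obtain ⟨q, hq⟩ := hp
  have h := schurCount_progression_le (p := p) (m := (p - a + 1) / 2) (a := a) (by omega)
  rw [← middleSet_eq_progression ⟨q, hq⟩ (by omega), show a - (p - a + 1) / 2 = 0 by omega,
    show 2 * a + (p - a + 1) / 2 - 1 - p = 0 by omega] at h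
  simpa [triangle] using h

lemma schurCount_middleSet_le (hp : Odd p) {a : ℕ} (ha : a ≤ p) (ha' : p + 2 ≤ 3 * a) :
    schurCount (middleSet p a) ≤ (3 * a - p) ^ 2 / 4 := by
  have h := schurCount_progression_le (p := p) (m := (p - a + 1) / 2) (a := a) (by omega)
  rw [← middleSet_eq_progression hp ha] at h
  have h1 := two_mul_card_triangle_le (a - (p - a + 1) / 2)
  have h2 := two_mul_card_triangle_le (2 * a + (p - a + 1) / 2 - 1 - p)
  obtain ⟨n, hn | hn⟩ : ∃ n, 3 * a - p = 0 + 2 * n ∨ 3 * a - p = 1 + 2 * n :=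
    ⟨(3 * a - p) / 2, by omega⟩
  · obtain ⟨k, rfl⟩ : ∃ k, n = k + 1 := ⟨n - 1, by omega⟩
    rw [hn, add_two_mul_sq_div_four]
    rw [show a - (p - a + 1) / 2 = k + 1 by omega] at h h1
    rw [show 2 * a + (p - a + 1) / 2 - 1 - p = k by omega] at h h2
    norm_num
    nlinarith
  · rw [hn, add_two_mul_sq_div_four]
    rw [show a - (p - a + 1) / 2 = n by omega] at h h1
    rw [show 2 * a + (p - a + 1) / 2 - 1 - p = n by omega] at h h2
    norm_num
    nlinarith

/-- The relation between `ST(A)` and a solution count to which Pollard's theorem applies. -/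
lemma schurCount_sq_div_four_identity {A : Finset (ZMod p)} (ha' : p ≤ 3 * #A) :
    sumCount Aᶜ Aᶜ Aᶜ + #Aᶜ ^ 2 / 4 + schurCount A
      = #Aᶜ * #Aᶜ + (3 * #A - p) ^ 2 / 4 := by
  have h1 := schurCount_add_schurCount_compl A
  rw [schurCount_eq_sumCount Aᶜ] at h1
  have hc : #Aᶜ + #A = p := by rw [Finset.card_compl_add_card, ZMod.card]
  -- Both bases equal #A + p; expanding each side relates the two floors.
  have h2 : (3 * #A - p + 2 * #Aᶜ) ^ 2 / 4 = (#Aᶜ + 2 * #A) ^ 2 / 4 := by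
    congr 2; omega
  rw [add_two_mul_sq_div_four, add_two_mul_sq_div_four] at h2
  have h3 : 3 * #A - p + #Aᶜ = 2 * #A := by omega
  rw [h3] at h2
  nlinarith

lemma sq_div_four_le_schurCount (hp : Odd p) {A : Finset (ZMod p)} (ha' : p ≤ 3 * #A) :
    (3 * #A - p) ^ 2 / 4 ≤ schurCount A := by
  obtain ⟨q, hq⟩ := hp
  have hc : #Aᶜ + #A = p := by rw [Finset.card_compl_add_card, ZMod.card]
  by_cases h : 2 * #A ≤ p
  · have h1 := sumCount_add_sq_div_four_le A A Aᶜ (3 * #A - p) le_rfl (by omega) (by omega)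
      (by omega)
    have h2 := schurCount_add_sumCount_compl A
    omega
  · have h1 := sumCount_add_sq_div_four_le Aᶜ Aᶜ Aᶜ #Aᶜ le_rfl (by omega) (by omega) (by omega)
    have h2 := schurCount_sq_div_four_identity ha'
    omega

lemma schurCount_middleSet (hp : Odd p) {a : ℕ} (ha : a ≤ p) (ha' : p + 2 ≤ 3 * a) :
    schurCount (middleSet p a) = (3 * a - p) ^ 2 / 4 := by
  have hc := card_middleSet hp ha
  refine le_antisymm (schurCount_middleSet_le hp ha ha') ?_
  have := sq_div_four_le_schurCount hp (A := middleSet p a) (by omega)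
  rwa [hc] at this

end MiddleSet

/-! ### Extremal sets are dilates of the middle set -/

section Uniqueness

open Finset
open scoped Pointwise

variable {p : ℕ} [Fact p.Prime]

lemma exists_isProgression_compl (hp : Odd p) {A : Finset (ZMod p)} (ha : 1 ≤ #Aᶜ)
    (ha' : p + 2 ≤ 3 * #A) (hA : schurCount A = (3 * #A - p) ^ 2 / 4) :
    ∃ d : ZMod p, d ≠ 0 ∧ IsProgression d Aᶜ := by
  obtain ⟨q, hq⟩ := hp
  have hc : #Aᶜ + #A = p := by rw [Finset.card_compl_add_card, ZMod.card]
  by_cases h : 2 * #A ≤ p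
  · have h2 := schurCount_add_sumCount_compl A
    exact exists_isProgression_of_sumCount_eq A A Aᶜ (3 * #A - p) le_rfl (by omega) (by omega)
      (by omega) (by omega) (by omega)
  -- Here s = #Aᶜ, and the equality theorem needs s ≥ 2.
  · rcases Nat.eq_or_lt_of_le ha with h1 | h1
    · obtain ⟨v, hv⟩ := Finset.card_eq_one.1 h1.symm
      exact ⟨1, one_ne_zero, v, by rw [hv]; simp [progression]⟩
    · have h2 := schurCount_sq_div_four_identity (A := A) (by omega)
      exact exists_isProgression_of_sumCount_eq Aᶜ Aᶜ Aᶜ #Aᶜ le_rfl (by omega) (by omega)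
        h1 (by omega) (by omega)

/-- Offsets add up to at most 2x - 2 < p, so i + k = j holds in `ℕ` and `i` runs over [j + 1 - x,
min (j + 1) x). -/
lemma sumCount_progression_singleton_le {s : ZMod p} {x j : ℕ} (hx : 2 * x ≤ p + 1) (hj : j < p) :
    sumCount (progression 1 s x) (progression 1 s x) {s + s + (j : ZMod p)}
      ≤ min (j + 1) x - (j + 1 - x) := by
  have h0 : sumCount (progression 1 s x) (progression 1 s x) {s + s + (j : ZMod p)}
      = #((progression 1 s x ×ˢ progression 1 s x).filter fun q =>
          q.1 + q.2 ∈ ({s + s + (j : ZMod p)} : Finset (ZMod p))) := by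
    rw [Finset.card_filter, Finset.sum_product]; rfl
  rw [h0, ← Nat.card_Ico]
  refine (Finset.card_le_card ?_).trans (Finset.card_image_le
    (f := fun i : ℕ => (s + (i : ZMod p), s + ((j - i : ℕ) : ZMod p))))
  rintro ⟨u, w⟩ h
  simp only [Finset.mem_filter, Finset.mem_product, mem_progression, Finset.mem_singleton] at h
  obtain ⟨⟨⟨i, hi, rfl⟩, ⟨k, hk, rfl⟩⟩, h⟩ := h
  have hik : i + k = j := by
    refine natCast_mul_inj (p := p) one_ne_zero (by omega) hj ?_
    push_cast
    linear_combination h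
  refine Finset.mem_image.2 ⟨i, Finset.mem_Ico.2 ⟨by omega, by omega⟩, ?_⟩
  rw [show j - i = k by omega, mul_one, mul_one]

/-- If `X` and `C` are intervals and `C` consists of the most popular sums of `X + X`, then `C` is
centred in `X + X`. -/
lemma exists_offset_of_sumCount_eq {s v : ZMod p} {x c r : ℕ} (hx : 2 * x + 1 ≤ p) (hc : 1 ≤ c)
    (hr : c + r = 2 * x) (hr1 : 1 ≤ r)
    (hT : sumCount (progression 1 s x) (progression 1 s x) (progression 1 v c) + r ^ 2 / 4
      = x * x) :
    ∃ l : ℕ, v = s + s + l ∧ r ≤ 2 * l + 2 ∧ 2 * l ≤ r := by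
  have hXc : #(progression 1 s x) = x := card_progression one_ne_zero s (by omega)
  have hCc : #(progression 1 v c) = c := card_progression one_ne_zero v (by omega)
  -- Deleting `z` from `C` raises `r` by one and Pollard's deficit by ⌊(r + 1)/2⌋, so `z` has at
  -- least that many representations.
  have hpop : ∀ z ∈ progression 1 v c,
      (r + 1) / 2 ≤ sumCount (progression 1 s x) (progression 1 s x) {z} := by
    intro z hz
    have h1 := sumCount_add_sq_div_four_le (progression 1 s x) (progression 1 s x)
      ((progression 1 v c).erase z) (r + 1) le_rfl (by omega)
      (by rw [Finset.card_erase_of_mem hz]; omega) (by omega)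
    have h2 := sumCount_union_target (progression 1 s x) (progression 1 s x)
      (C := (progression 1 v c).erase z) (C' := {z}) (by simp)
    rw [show (progression 1 v c).erase z ∪ {z} = progression 1 v c by
      rw [Finset.union_comm, ← Finset.insert_eq, Finset.insert_erase hz]] at h2
    have h3 : (r + 1) ^ 2 / 4 = r ^ 2 / 4 + (r + 1) / 2 := by
      obtain ⟨n, hn | hn⟩ : ∃ n, r = 0 + 2 * n ∨ r = 1 + 2 * n := ⟨r / 2, by omega⟩
      · rw [show r + 1 = 1 + 2 * n by omega, hn, add_two_mul_sq_div_four, add_two_mul_sq_div_four,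
          show (1 + 2 * n) / 2 = n by omega]
        norm_num; ring
      · rw [show r + 1 = 0 + 2 * (n + 1) by omega, hn, add_two_mul_sq_div_four,
          add_two_mul_sq_div_four, show (0 + 2 * (n + 1)) / 2 = n + 1 by omega]
        norm_num; ring
    rw [hXc] at h1
    omega
  have hpop' : ∀ z ∈ progression 1 v c, ∀ j < p, z = s + s + (j : ZMod p) →
      (r + 1) / 2 ≤ min (j + 1) x - (j + 1 - x) := by
    rintro z hz j hj rfl
    exact (hpop _ hz).trans (sumCount_progression_singleton_le (by omega) hj)
  obtain ⟨l, hl, hlv⟩ := exists_eq_add_mul (p := p) one_ne_zero (s + s) v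
  obtain ⟨l', hl', hlv'⟩ := exists_eq_add_mul (p := p) one_ne_zero (s + s) (v + (c - 1 : ℕ))
  rw [mul_one] at hlv hlv'
  have h1 := hpop' v (mem_progression.2 ⟨0, by omega, by simp⟩) l hl hlv.symm
  have h2 := hpop' _ (mem_progression.2 ⟨c - 1, by omega, by simp⟩) l' hl' hlv'.symm
  have h3 : ((l + (c - 1) : ℕ) : ZMod p) = (l' : ZMod p) := by
    push_cast
    linear_combination hlv - hlv'
  rcases natCast_eq_of_lt_two_mul (by omega) hl' h3 with h4 | h4
  · exact ⟨l, hlv.symm, by omega, by omega⟩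
  -- If `C` wrapped around, it would contain 2s + (2x - 1), which is not a sum.
  · exfalso
    have h5 := hpop' (v + (2 * x - 1 - l : ℕ))
      (mem_progression.2 ⟨2 * x - 1 - l, by omega, by simp⟩) (2 * x - 1) (by omega) (by
        rw [← hlv, add_assoc, ← Nat.cast_add, show l + (2 * x - 1 - l) = 2 * x - 1 by omega])
    omega

/-- An extremal interval is `middleSet p a` or its negative. -/
lemma eq_or_eq_neg_middleSet (hp : Odd p) {A : Finset (ZMod p)} (hc1 : 1 ≤ #Aᶜ)
    (ha' : p + 2 ≤ 3 * #A) (hA : schurCount A = (3 * #A - p) ^ 2 / 4)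
    (hprog : IsProgression 1 Aᶜ) : A = middleSet p #A ∨ A = -middleSet p #A := by
  have hc : #Aᶜ + #A = p := by rw [Finset.card_compl_add_card, ZMod.card]
  obtain ⟨q, hq⟩ := hp
  obtain ⟨v, hv⟩ := hprog
  have hAp : A = progression 1 (v + (#Aᶜ : ZMod p)) #A := by
    have h := compl_progression (p := p) one_ne_zero v (n := #Aᶜ) (by omega)
    rw [← hv, compl_compl, mul_one, show p - #Aᶜ = #A by omega] at h
    exact h
  have hcast : ((#Aᶜ : ℕ) : ZMod p) + (#A : ZMod p) = 0 := by
    rw [← Nat.cast_add, hc, ZMod.natCast_self]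
  -- `k` is the first element of `A`. When p - #A is even, centring leaves two positions, exchanged
  -- by negation.
  obtain ⟨k, hk, hk'⟩ : ∃ k : ℕ, v + (#Aᶜ : ZMod p) = k ∧
      (k = (p - #A + 1) / 2 ∨ (k = (p - #A + 1) / 2 + 1 ∧ 2 * k + #A = p + 2)) := by
    by_cases h : 2 * #A ≤ p
    · have h2 := schurCount_add_sumCount_compl A
      have h3 : sumCount A A Aᶜ + (3 * #A - p) ^ 2 / 4 = #A * #A := by omega
      rw [show sumCount A A Aᶜ = sumCount (progression 1 (v + (#Aᶜ : ZMod p)) #A)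
        (progression 1 (v + (#Aᶜ : ZMod p)) #A) (progression 1 v #Aᶜ) by rw [← hAp, ← hv]] at h3
      obtain ⟨l, hl, hl1, hl2⟩ := exists_offset_of_sumCount_eq (by omega) hc1 (by omega)
        (by omega) h3
      refine ⟨#A - l, ?_, by omega⟩
      rw [Nat.cast_sub (by omega)]
      linear_combination -hl - hcast
    · have h2 := schurCount_sq_div_four_identity (A := A) (by omega)
      have h3 : sumCount Aᶜ Aᶜ Aᶜ + #Aᶜ ^ 2 / 4 = #Aᶜ * #Aᶜ := by omega
      rw [show sumCount Aᶜ Aᶜ Aᶜ = sumCount (progression 1 v #Aᶜ) (progression 1 v #Aᶜ)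
        (progression 1 v #Aᶜ) by rw [← hv]] at h3
      obtain ⟨l, hl, hl1, hl2⟩ := exists_offset_of_sumCount_eq (by omega) hc1 (by omega)
        (by omega) h3
      refine ⟨#Aᶜ - l, ?_, by omega⟩
      rw [Nat.cast_sub (by omega)]
      linear_combination -hl
  rw [hk] at hAp
  rcases hk' with rfl | ⟨hk1, hk2⟩
  · left
    rw [middleSet_eq_progression ⟨q, hq⟩ (by omega)]
    exact hAp
  · right
    obtain ⟨n, hn⟩ : ∃ n, #A = n + 1 := ⟨#A - 1, by omega⟩
    rw [middleSet_eq_progression ⟨q, hq⟩ (by omega), show (p - #A + 1) / 2 = k - 1 by omega, hn,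
      progression_neg, ← hn, mul_one]
    refine hAp.trans (congrArg (fun t => progression 1 t #A) ?_)
    have h : ((k + (k - 1 + n) : ℕ) : ZMod p) = 0 := by
      rw [show k + (k - 1 + n) = p by omega, ZMod.natCast_self]
    push_cast at h
    linear_combination h

lemma schurCount_image_mul {ξ : ZMod p} (hξ : ξ ≠ 0) (A : Finset (ZMod p)) :
    schurCount (A.image (ξ * ·)) = schurCount A := by
  have hinj : Function.Injective (ξ * · : ZMod p → ZMod p) := mul_right_injective₀ hξ
  simp only [schurCount_eq_sumCount, sumCount]
  rw [Finset.sum_image hinj.injOn]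
  refine Finset.sum_congr rfl fun x _ => ?_
  rw [Finset.sum_image hinj.injOn]
  refine Finset.sum_congr rfl fun y _ => ?_
  rw [← mul_add]
  simp only [hinj.mem_finset_image]

lemma image_mul_image_mul (ξ η : ZMod p) (A : Finset (ZMod p)) :
    (A.image (η * ·)).image (ξ * ·) = A.image (ξ * η * ·) := by
  rw [Finset.image_image]
  congr 1
  ext x
  simp [mul_assoc]

/-- Every extremal set is a dilate of the middle set. -/
theorem exists_eq_image_mul_middleSet (hp : Odd p) {A : Finset (ZMod p)} (ha' : p + 2 ≤ 3 * #A)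
    (hA : schurCount A = (3 * #A - p) ^ 2 / 4) :
    ∃ ξ : ZMod p, ξ ≠ 0 ∧ A = (middleSet p #A).image (ξ * ·) := by
  have hc : #Aᶜ + #A = p := by rw [Finset.card_compl_add_card, ZMod.card]
  rcases Nat.eq_zero_or_pos #Aᶜ with h0 | h0
  · have h1 : A = Finset.univ := by rw [← Finset.card_eq_iff_eq_univ, ZMod.card]; omega
    have h2 : middleSet p #A = Finset.univ := by
      rw [← Finset.card_eq_iff_eq_univ, ZMod.card, card_middleSet hp (by omega)]; omega
    exact ⟨1, one_ne_zero, by rw [h2]; simpa using h1⟩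
  obtain ⟨d, hd, v, hv⟩ := exists_isProgression_compl hp h0 ha' hA
  have hd' : d⁻¹ ≠ 0 := inv_ne_zero hd
  have hinj : Function.Injective (d⁻¹ * · : ZMod p → ZMod p) := mul_right_injective₀ hd'
  have hbij : Function.Bijective (d⁻¹ * · : ZMod p → ZMod p) :=
    Finite.injective_iff_bijective.1 hinj
  set A' := A.image (d⁻¹ * ·) with hA'
  have hcard : #A' = #A := Finset.card_image_of_injective A hinj
  have hcompl : A'ᶜ = Aᶜ.image (d⁻¹ * ·) := by
    apply Finset.coe_injective
    simp only [hA', Finset.coe_compl, Finset.coe_image]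
    exact (Set.image_compl_eq hbij).symm
  have hprog : IsProgression 1 A'ᶜ := by
    rw [hcompl, hv, image_mul_progression, inv_mul_cancel₀ hd]
    exact isProgression_progression one_ne_zero _ (by omega)
  have hcc : #A'ᶜ + #A' = p := by rw [Finset.card_compl_add_card, ZMod.card]
  have hmul : A = A'.image (d * ·) := by
    rw [hA', image_mul_image_mul, mul_inv_cancel₀ hd]; simp
  rcases eq_or_eq_neg_middleSet hp (A := A') (by omega) (by omega)
    (by rw [hA', schurCount_image_mul hd', ← hA', hcard]; exact hA) hprog with h | h
  · refine ⟨d, hd, ?_⟩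
    rw [hcard] at h
    rwa [h] at hmul
  · refine ⟨-d, neg_ne_zero.2 hd, ?_⟩
    rw [hcard] at h
    have hneg : -middleSet p #A = (middleSet p #A).image (-1 * ·) := by
      simp only [neg_one_mul, Finset.image_neg_eq_neg]
    rw [h, hneg, image_mul_image_mul] at hmul
    simpa using hmul

end Uniqueness

/-! ### The stated formula and the theorem -/

lemma floor_mul_ceil_half (s : ℕ) :
    ⌊(s : ℚ) / 2⌋ * ⌈(s : ℚ) / 2⌉ = ((s ^ 2 / 4 : ℕ) : ℤ) := by
  obtain ⟨n, hn | hn⟩ : ∃ n, s = 0 + 2 * n ∨ s = 1 + 2 * n := ⟨s / 2, by omega⟩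
  · have h1 : (s : ℚ) / 2 = ((n : ℤ) : ℚ) := by rw [hn]; push_cast; ring
    rw [h1, Int.floor_intCast, Int.ceil_intCast, hn, add_two_mul_sq_div_four]
    norm_num
  · have h1 : ⌊(s : ℚ) / 2⌋ = (n : ℤ) := by
      rw [Int.floor_eq_iff, hn]; push_cast; constructor <;> linarith
    have h2 : ⌈(s : ℚ) / 2⌉ = (n : ℤ) + 1 := by
      rw [Int.ceil_eq_iff, hn]; push_cast; constructor <;> linarith
    rw [h1, h2, hn, add_two_mul_sq_div_four, show 1 ^ 2 / 4 = 0 from rfl]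
    push_cast
    ring

theorem theorem1 (p : ℕ) [Fact p.Prime] (hp : Odd p) :
    -- `x_1, …, x_p` is an ordering of all elements of `ZMod p`
    Set.BijOn (middleOut p) (Set.Icc 1 p) Set.univ ∧
    ∀ (a : ℕ) (A : Finset (ZMod p)), A.card = a →
      schurCount (middleSet p a) ≤ schurCount A ∧
      (schurCount (middleSet p a) : ℤ) =
        (if (a : ℚ) ≤ ((p : ℚ) + 1) / 3 then 0
          else ⌊(3 * (a : ℚ) - (p : ℚ)) / 2⌋ * ⌈(3 * (a : ℚ) - (p : ℚ)) / 2⌉) ∧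
      (0 < schurCount (middleSet p a) → schurCount A = schurCount (middleSet p a) →
        (∃ φ : ZMod p ≃+ ZMod p, A = (middleSet p a).image φ) ∧
        (∃ ξ : ZMod p, ξ ≠ 0 ∧ A = (middleSet p a).image (fun x => ξ * x))) := by
  refine ⟨bijOn_middleOut hp, ?_⟩
  rintro _ A rfl
  have hap := card_le_prime A
  by_cases ha : 3 * A.card ≤ p + 1
  · have h0 := schurCount_middleSet_eq_zero hp ha
    refine ⟨by omega, ?_, by omega⟩
    rw [h0, if_pos, Nat.cast_zero]
    rw [le_div_iff₀ (by norm_num)]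
    have : ((3 * A.card : ℕ) : ℚ) ≤ ((p + 1 : ℕ) : ℚ) := Nat.cast_le.2 ha
    push_cast at this
    linarith
  · have ha' : p + 2 ≤ 3 * A.card := by omega
    have h0 := schurCount_middleSet hp hap ha'
    refine ⟨?_, ?_, ?_⟩
    · rw [h0]
      exact sq_div_four_le_schurCount hp (by omega)
    · rw [h0, if_neg, ← floor_mul_ceil_half, Nat.cast_sub (by omega)]
      · push_cast
        rfl
      · rw [le_div_iff₀ (by norm_num)]
        have : ((p + 2 : ℕ) : ℚ) ≤ ((3 * A.card : ℕ) : ℚ) := Nat.cast_le.2 ha'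
        push_cast at this
        linarith
    · intro _ hA
      obtain ⟨ξ, hξ, h⟩ := exists_eq_image_mul_middleSet hp ha' (hA.trans h0)
      refine ⟨⟨{ Equiv.mulLeft₀ ξ hξ with map_add' := mul_add ξ }, h⟩, ξ, hξ, h⟩
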